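/- Let $\mathbb{T}^2=\mathbb{R}^2/\mathbb{Z}^2$ with Lebesgue (Haar) probability measure $\mu$, let $T(\omega_1,\omega_2)=(2\omega_1+\omega_2,\ \omega_1+\omega_2) \bmod \mathbb{Z}^2$ be the cat map, and let $\vec u=\left(\tfrac{1+\sqrt5}{2},\,1\right)$ be its unstable vector. Let $v:\mathbb{T}^2\to\mathbb{R}$ be a measurable function with $|v|\le 1$ such that, with $\mathbb{T}^2$ identified with $[0,1)^2$, $v$ is of class $C^1$ on $[0,1)^2$ (one-sided derivatives on the left and lower edges; $v$ need not be continuous on $\mathbb{T}^2$) and there are constants $c>0$ and $M$ with $$c< D_{\vec u}v(\omega)\le M\qquad\text{for all }\omega\in[0,1)^2 .$$ For $t\in\mathbb{R}$ and $\lambda>0$ put $g(\omega,t)=(t-v(\omega))^2+1$, $\theta(\omega,t)=\cot^{-1}(t-v(\omega))\in(0,\pi)$, $$A(\omega,t,\lambda)=\begin{pmatrix}\lambda\sqrt{g(T\omega,t)}&0\\0&\frac1\lambda\sqrt{\frac1{g(T\omega,t)}}\end{pmatrix}\begin{pmatrix}\cos\theta(\omega,t)&-\sin\theta(\omega,t)\\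 \sin\theta(\omega,t)&\cos\theta(\omega,t)\end{pmatrix},$$ and $A_n(\omega)=A(T^{n-1}\omega,t,\lambda)\cdots A(T\omega,t,\lambda)A(\omega,t,\lambda)$. Then there is a constant $C_0=C_0(v)>0$ such that for every $\lambda>0$ and every $t\in[-1,2]$ the functions $\log\|A_n\|$ are $\mu$-integrable, the Lyapunov exponent $$L(t;\lambda)=\lim_{n\to\infty}\frac1n\int_{\mathbb{T}^2}\log\|A_n(\omega)\|\,d\mu(\omega)$$ exists, and $$L(t;\lambda)>\log\lambda-C_0 .$$ -/

import Mathlib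

namespace CatMap

noncomputable section

/-- The two-dimensional torus `ℝ² / ℤ²`. Its `volume` is the product of the normalized
Haar (Lebesgue) measures of the two circles. -/
abbrev Torus : Type := UnitAddCircle × UnitAddCircle

/-- Arnold's cat map `(x, y) ↦ (2x + y, x + y)` on the torus. -/
def catMap (ω : Torus) : Torus := (2 • ω.1 + ω.2, ω.1 + ω.2)

/-- The unstable vector of the cat map (eigenvector for the eigenvalue `(3 + √5) / 2`). -/
def unstableVector : ℝ × ℝ := ((1 + √5) / 2, 1)

/-- The half-open unit square `[0,1)²`, a fundamental domain of the torus. -/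
def unitSquare : Set (ℝ × ℝ) := Set.Ico 0 1 ×ˢ Set.Ico 0 1

/-- A function on the torus, read in the coordinates of the plane. -/
def lift (v : Torus → ℝ) (p : ℝ × ℝ) : ℝ := v ((p.1 : UnitAddCircle), (p.2 : UnitAddCircle))

/-- The directional derivative of `v` in the unstable direction at a point of `[0,1)²`; at the
points of the left and lower edges the derivative is the one within the square. -/
def unstableDeriv (v : Torus → ℝ) (p : ℝ × ℝ) : ℝ :=
  fderivWithin ℝ (lift v) unitSquare p unstableVector

/-- The potentials under consideration: measurable, bounded by one, of class `C¹` on `[0,1)²`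
(discontinuities across the boundary of the fundamental domain are allowed), with a directional
derivative in the unstable direction that lies between two positive constants. -/
structure IsAdmissiblePotential (v : Torus → ℝ) : Prop where
  measurable : Measurable v
  abs_le_one : ∀ ω, |v ω| ≤ 1
  contDiffOn : ContDiffOn ℝ 1 (lift v) unitSquare
  unstableDeriv_lower : ∃ c > 0, ∀ p ∈ unitSquare, c < unstableDeriv v p
  unstableDeriv_upper : ∃ M, ∀ p ∈ unitSquare, unstableDeriv v p ≤ M

/-- The inverse cotangent, with values in `(0, π)`. -/
def arccot (x : ℝ) : ℝ := Real.pi / 2 - Real.arctan x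

/-- The counterclockwise rotation by the angle `γ`. -/
def rotation (γ : ℝ) : Matrix (Fin 2) (Fin 2) ℝ :=
  !![Real.cos γ, -Real.sin γ; Real.sin γ, Real.cos γ]

/-- `g(ω, t) = (t - v(ω))² + 1`. -/
def gFun (v : Torus → ℝ) (t : ℝ) (ω : Torus) : ℝ := (t - v ω) ^ 2 + 1

/-- `θ(ω, t) = arccot (t - v(ω))`. -/
def theta (v : Torus → ℝ) (t : ℝ) (ω : Torus) : ℝ := arccot (t - v ω)

/-- The reduced cocycle map
`A(ω, t, l) = diag(l √g(Tω, t), l⁻¹ √(1 / g(Tω, t))) R_{θ(ω, t)}`. -/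
def cocycle (v : Torus → ℝ) (t l : ℝ) (ω : Torus) : Matrix (Fin 2) (Fin 2) ℝ :=
  !![l * √(gFun v t (catMap ω)), 0; 0, 1 / l * √(1 / gFun v t (catMap ω))] *
    rotation (theta v t ω)

/-- The iterates `A_n(ω) = A(Tⁿ⁻¹ω) ⋯ A(Tω) A(ω)`, with `A_0 = 1`. -/
def cocycleIter (v : Torus → ℝ) (t l : ℝ) : ℕ → Torus → Matrix (Fin 2) (Fin 2) ℝ
  | 0, _ => 1
  | n + 1, ω => cocycle v t l (catMap^[n] ω) * cocycleIter v t l n ω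

/-- `log ‖A_n(ω)‖`, where `‖·‖` is the operator norm on the Euclidean plane. -/
def logNormIter (v : Torus → ℝ) (t l : ℝ) (n : ℕ) (ω : Torus) : ℝ :=
  Real.log ‖Matrix.toEuclideanCLM (𝕜 := ℝ) (cocycleIter v t l n ω)‖

/-- `(1 / n) ∫ log ‖A_n‖`. -/
def meanLogNorm (v : Torus → ℝ) (t l : ℝ) (n : ℕ) : ℝ :=
  1 / (n : ℝ) * ∫ ω : Torus, logNormIter v t l n ω

/-- The Lyapunov exponent `L(t; l) = lim (1 / n) ∫ log ‖A_n‖` of the cocycle over the cat map. -/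
def lyapunovExponent (v : Torus → ℝ) (t l : ℝ) : ℝ :=
  Filter.limUnder Filter.atTop (meanLogNorm v t l)

end

end CatMap

/-! Follow the angle `x_k` of `R_{θ_k} A_k e₁`. The k-th diagonal factor multiplies the length by
`λ√g ≥ λ` times `√(cos² x_k + τ² sin² x_k)`, where `τ = 1/(λ²g)`. So `log ‖A_n‖ ≥ n log λ - ∑
loss(x_k)` (`le_logNormIter`), and it suffices to bound the mean loss uniformly in `k` and `λ`. The
loss is large only for `x_k` near `π/2` mod `π`.

For large `λ` this is an equidistribution argument on unstable segments. There `v ∘ T^k` grows at a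
rate comparable to `α^k` between jumps, and `x_k` inherits the lower bound `x_k' ≥ (c/20) α^k`
(`exists_hasDerivAt_pruferAngle`). Conversely, `x_{k+1} - x_k` is bounded and there are `O(α^k)`
jumps, so `∫ x_k' = O(α^k)` (`integral_deriv_pruferAngle_le`). The loss minus its mean has a bounded
primitive `ψ`. Integrating `(ψ ∘ x_k)'` between jumps bounds `∫ loss(x_k) x_k'` by `O(α^k)`, and
dividing by the lower bound for `x_k'` gives `O(1)` (`integral_logLoss_le`). Translation invariance
and Fubini pass from segments to the torus.

For bounded `λ`, `det A_n = 1` gives `L ≥ 0`, and a larger constant suffices. -/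

namespace CatMap

noncomputable section

open Real

/-! ### The action of a diagonal matrix on angles -/

/-- The angle of the vector `(cos x, τ sin x)`, chosen continuously in `x` with `angleMap τ 0 = 0`. -/
def angleMap (τ x : ℝ) : ℝ :=
  x - arctan ((1 - τ) * (sin x * cos x) / (cos x ^ 2 + τ * sin x ^ 2))

lemma cos_sq_add_mul_sin_sq_pos {τ : ℝ} (hτ : 0 < τ) (x : ℝ) : 0 < cos x ^ 2 + τ * sin x ^ 2 := by
  rcases eq_or_ne (sin x) 0 with h | h
  · have := sin_sq_add_cos_sq x
    rw [h] at this ⊢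
    nlinarith
  · positivity

/-- Writing `C`, `S` for cosine and sine: `(C² + τS²)² + (1 - τ)²S²C² = (C² + S²)(C² + τ²S²)`. The
fraction is the tangent of the angle lost, and its denominator never vanishes, so a single branch of
`arctan` serves for all `x`. -/
lemma one_add_sq_angleMap {τ : ℝ} (hτ : 0 < τ) (x : ℝ) :
    1 + ((1 - τ) * (sin x * cos x) / (cos x ^ 2 + τ * sin x ^ 2)) ^ 2 =
      (cos x ^ 2 + τ ^ 2 * sin x ^ 2) / (cos x ^ 2 + τ * sin x ^ 2) ^ 2 := by
  have hD := (cos_sq_add_mul_sin_sq_pos hτ x).ne'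
  rw [div_pow, eq_div_iff (pow_ne_zero 2 hD), add_mul, div_mul_cancel₀ _ (pow_ne_zero 2 hD)]
  have h := sin_sq_add_cos_sq x
  have hs : sin x ^ 2 = 1 - cos x ^ 2 := by linarith
  simp only [mul_pow, hs]
  ring

lemma sqrt_mul_cos_angleMap {τ : ℝ} (hτ : 0 < τ) (x : ℝ) :
    √(cos x ^ 2 + τ ^ 2 * sin x ^ 2) * cos (angleMap τ x) = cos x := by
  have hD := cos_sq_add_mul_sin_sq_pos hτ x
  have hΔ := cos_sq_add_mul_sin_sq_pos (pow_pos hτ 2) x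
  have hr := (sqrt_pos.2 hΔ).ne'
  rw [angleMap, cos_sub, cos_arctan, sin_arctan, one_add_sq_angleMap hτ, sqrt_div hΔ.le,
    sqrt_sq hD.le]
  have hs : sin x ^ 2 = 1 - cos x ^ 2 := by linarith [sin_sq_add_cos_sq x]
  have hD' := hD.ne'
  field_simp
  rw [hs]
  ring

lemma sqrt_mul_sin_angleMap {τ : ℝ} (hτ : 0 < τ) (x : ℝ) :
    √(cos x ^ 2 + τ ^ 2 * sin x ^ 2) * sin (angleMap τ x) = τ * sin x := by
  have hD := cos_sq_add_mul_sin_sq_pos hτ x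
  have hΔ := cos_sq_add_mul_sin_sq_pos (pow_pos hτ 2) x
  have hr := (sqrt_pos.2 hΔ).ne'
  rw [angleMap, sin_sub, cos_arctan, sin_arctan, one_add_sq_angleMap hτ, sqrt_div hΔ.le,
    sqrt_sq hD.le]
  have hs : cos x ^ 2 = 1 - sin x ^ 2 := by linarith [sin_sq_add_cos_sq x]
  have hD' := hD.ne'
  field_simp
  rw [hs]
  ring

/-- This bounds the one-step increment of the angle, although the angle itself may grow without
bound in time. -/
lemma abs_angleMap_sub_self_le (τ x : ℝ) : |angleMap τ x - x| ≤ π / 2 := by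
  rw [angleMap, sub_sub_cancel_left, abs_neg, abs_le]
  exact ⟨(neg_pi_div_two_lt_arctan _).le, (arctan_lt_pi_div_two _).le⟩

lemma hasDerivAt_angleMap {τ x : ℝ → ℝ} {τ' x' s : ℝ} (hτ : HasDerivAt τ τ' s)
    (hx : HasDerivAt x x' s) (hpos : 0 < τ s) :
    HasDerivAt (fun s => angleMap (τ s) (x s))
      ((τ s * x' + sin (x s) * cos (x s) * τ') / (cos (x s) ^ 2 + τ s ^ 2 * sin (x s) ^ 2)) s := by
  have hD := (cos_sq_add_mul_sin_sq_pos hpos (x s)).ne'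
  have hΔ := (cos_sq_add_mul_sin_sq_pos (pow_pos hpos 2) (x s)).ne'
  have hsin := hx.sin
  have hcos := hx.cos
  have hN := (hτ.const_sub 1).mul (hsin.mul hcos)
  have hDen := (hcos.pow 2).add (hτ.mul (hsin.pow 2))
  refine (hx.sub ((hN.div hDen hD).arctan)).congr_deriv ?_
  simp only [Pi.mul_apply, Pi.pow_apply, Pi.add_apply, Pi.div_apply]
  rw [one_add_sq_angleMap hpos]
  field_simp
  simp only [Nat.cast_ofNat, Nat.add_one_sub_one, pow_one]
  linear_combination -(x' * ((1 - τ s) * (cos (x s) ^ 2 - τ s * sin (x s) ^ 2) - τ s) -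
    sin (x s) * cos (x s) * τ') * sin_sq_add_cos_sq (x s)

/-! ### Angle recursion, loss function and integration across jumps -/

/-- The angles of the vectors `R_{θ_k} A_k e₁` in terms of the values `a k` of the potential along
an orbit. -/
def pruferAngle (t l : ℝ) (a : ℕ → ℝ) : ℕ → ℝ
  | 0 => arccot (t - a 0)
  | k + 1 => arccot (t - a (k + 1)) +
      angleMap (1 / (l ^ 2 * ((t - a (k + 1)) ^ 2 + 1))) (pruferAngle t l a k)

/-- A lower bound for the logarithmic loss of norm at angle `x`. -/
def logLoss (ε x : ℝ) : ℝ := -(1 / 2 * log (cos x ^ 2 + ε * sin x ^ 2))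

open MeasureTheory

/-- The derivative of a bounded function that is differentiable on an interval off a finite set has
an integral of the order of the number of exceptional points. -/
lemma integral_deriv_le_of_finite_exceptions {ψ ψ' : ℝ → ℝ} {K : ℝ} (hK : ∀ s, |ψ s| ≤ K)
    {a : ℝ} (B : Finset ℝ) : ∀ {b : ℝ}, a ≤ b → (∀ s ∈ Set.Ioo a b, s ∉ B → HasDerivAt ψ (ψ' s) s) →
    IntervalIntegrable ψ' volume a b → ∫ s in a..b, ψ' s ≤ 2 * K * (B.card + 1) := by
  have hK0 : 0 ≤ K := (abs_nonneg _).trans (hK 0)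
  -- Without exceptional points: `ψ` may jump at the endpoints, so the fundamental theorem is
  -- applied on interior intervals, followed by a limit in the continuous primitive of `ψ'`.
  have key : ∀ {a b : ℝ}, a ≤ b → (∀ s ∈ Set.Ioo a b, HasDerivAt ψ (ψ' s) s) →
      IntervalIntegrable ψ' volume a b → ∫ s in a..b, ψ' s ≤ 2 * K := by
    intro a b hab hd hi
    rcases hab.eq_or_lt with rfl | hab
    · simpa using hK0
    have hcont : ContinuousOn (fun x => ∫ s in a..x, ψ' s) (Set.Icc a b) := by
      simpa [Set.uIcc_of_le hab.le] using
        intervalIntegral.continuousOn_primitive_interval' hi Set.left_mem_uIcc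
    have hsub : ∀ {x y : ℝ}, a ≤ x → x ≤ y → y ≤ b → IntervalIntegrable ψ' volume x y := by
      intro x y hx hxy hy
      refine hi.mono_set ?_
      rw [Set.uIcc_of_le hxy, Set.uIcc_of_le hab.le]
      exact Set.Icc_subset_Icc hx hy
    have h1 : ∀ x y, a < x → x ≤ y → y < b →
        (∫ s in a..y, ψ' s) - (∫ s in a..x, ψ' s) ≤ 2 * K := by
      intro x y hx hxy hy
      rw [intervalIntegral.integral_interval_sub_left (hsub le_rfl (hx.le.trans hxy) hy.le)
        (hsub le_rfl hx.le (hxy.trans hy.le)),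
        intervalIntegral.integral_eq_sub_of_hasDerivAt (f := ψ) _ (hsub hx.le hxy hy.le)]
      · have := abs_le.1 (hK y)
        have := abs_le.1 (hK x)
        linarith
      · intro s hs
        rw [Set.uIcc_of_le hxy] at hs
        exact hd s ⟨hx.trans_le hs.1, hs.2.trans_lt hy⟩
    have h2 : ∀ x, a < x → x < b →
        (∫ s in a..b, ψ' s) - (∫ s in a..x, ψ' s) ≤ 2 * K := by
      intro x hx hxb
      have ht : Filter.Tendsto (fun y => (∫ s in a..y, ψ' s) - (∫ s in a..x, ψ' s))
          (nhdsWithin b (Set.Ioo x b)) (nhds ((∫ s in a..b, ψ' s) - (∫ s in a..x, ψ' s))) :=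
        ((hcont b ⟨hab.le, le_rfl⟩).mono
          (fun y hy => ⟨hx.le.trans hy.1.le, hy.2.le⟩)).sub_const _
      have : (nhdsWithin b (Set.Ioo x b)).NeBot := by
        rw [nhdsWithin_Ioo_eq_nhdsLT hxb]; infer_instance
      refine le_of_tendsto ht ?_
      filter_upwards [self_mem_nhdsWithin] with y hy
      exact h1 x y hx hy.1.le hy.2
    have ht : Filter.Tendsto (fun x => (∫ s in a..b, ψ' s) - (∫ s in a..x, ψ' s))
        (nhdsWithin a (Set.Ioo a b)) (nhds ((∫ s in a..b, ψ' s) - (∫ s in a..a, ψ' s))) :=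
      ((hcont a ⟨le_rfl, hab.le⟩).mono Set.Ioo_subset_Icc_self).const_sub _
    have : (nhdsWithin a (Set.Ioo a b)).NeBot := by
      rw [nhdsWithin_Ioo_eq_nhdsGT hab]; infer_instance
    have := le_of_tendsto ht (b := 2 * K) (by
      filter_upwards [self_mem_nhdsWithin] with x hx
      exact h2 x hx.1 hx.2)
    simpa using this
  -- The largest point `c` is inserted last, so no exceptional point lies to its right and `key`
  -- applies there.
  induction B using Finset.induction_on_max with
  | empty =>
    intro b hab hd hi
    simpa using key hab (fun s hs => hd s hs (Finset.notMem_empty s)) hi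
  | insert c B hmax ih =>
    intro b hab hd hi
    have hcard : (insert c B).card = B.card + 1 :=
      Finset.card_insert_of_notMem fun h => (hmax c h).false
    by_cases hc : c ∈ Set.Ioo a b
    · have hi1 : IntervalIntegrable ψ' volume a c := hi.mono_set (by
        rw [Set.uIcc_of_le hc.1.le, Set.uIcc_of_le hab]; exact Set.Icc_subset_Icc le_rfl hc.2.le)
      have hi2 : IntervalIntegrable ψ' volume c b := hi.mono_set (by
        rw [Set.uIcc_of_le hc.2.le, Set.uIcc_of_le hab]; exact Set.Icc_subset_Icc hc.1.le le_rfl)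
      have h1 := ih hc.1.le (fun s hs hsB => hd s ⟨hs.1, hs.2.trans hc.2⟩ (by
        simp [hsB, hs.2.ne])) hi1
      have h2 := key hc.2.le (fun s hs => hd s ⟨hc.1.trans hs.1, hs.2⟩ (by
        simp only [Finset.mem_insert, not_or]
        exact ⟨hs.1.ne', fun h => (hmax s h).not_gt hs.1⟩)) hi2
      rw [← intervalIntegral.integral_add_adjacent_intervals hi1 hi2, hcard]
      push_cast
      linarith
    · have h1 := ih hab (fun s hs hsB => hd s hs (by
        simp only [Finset.mem_insert, hsB, or_false]
        rintro rfl
        exact hc hs)) hi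
      rw [hcard]
      push_cast
      linarith

/-! ### The logarithmic loss -/

lemma continuous_logLoss {ε : ℝ} (hε : 0 < ε) : Continuous (logLoss ε) := by
  unfold logLoss
  have : ∀ x, cos x ^ 2 + ε * sin x ^ 2 ≠ 0 := fun x => (cos_sq_add_mul_sin_sq_pos hε x).ne'
  fun_prop (disch := assumption)

lemma logLoss_nonneg {ε : ℝ} (hε : 0 < ε) (hε1 : ε ≤ 1) (x : ℝ) : 0 ≤ logLoss ε x := by
  have h0 := (cos_sq_add_mul_sin_sq_pos hε x).le
  have h := log_nonpos h0 (by nlinarith [sin_sq_add_cos_sq x, sq_nonneg (sin x)])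
  unfold logLoss
  linarith

lemma logLoss_le_log {ε : ℝ} (hε : 0 < ε) (hε1 : ε ≤ 1) (x : ℝ) :
    logLoss ε x ≤ -(1 / 2 * log ε) := by
  have h : log ε ≤ log (cos x ^ 2 + ε * sin x ^ 2) :=
    log_le_log hε (by nlinarith [sin_sq_add_cos_sq x, sq_nonneg (cos x)])
  unfold logLoss
  linarith

/-- Dropping the `ε` term gives a majorant independent of `ε` and integrable over a period. As
`Real.log` is even, no sign of the cosine is needed. -/
lemma logLoss_le {ε : ℝ} (hε : 0 < ε) {x : ℝ} (hx : cos x ≠ 0) : logLoss ε x ≤ -log (cos x) := by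
  have h : log (cos x ^ 2) ≤ log (cos x ^ 2 + ε * sin x ^ 2) :=
    log_le_log (by positivity) (by nlinarith [sq_nonneg (sin x)])
  rw [log_pow] at h
  unfold logLoss
  push_cast at h
  linarith

lemma periodic_logLoss (ε : ℝ) : Function.Periodic (logLoss ε) π := by
  intro x
  simp [logLoss]

/-- The logarithmic loss is, up to a bounded constant, the derivative of a bounded function. -/
lemma exists_bounded_primitive_logLoss : ∃ K, 0 < K ∧ ∀ ε, 0 < ε → ε ≤ 1 →
    ∃ κ ψ, 0 ≤ κ ∧ κ ≤ K ∧ (∀ x, HasDerivAt ψ (logLoss ε x - κ) x) ∧ ∀ x, |ψ x| ≤ K := by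
  -- This dominates the integral of `logLoss ε` over a period for every `ε`; the `+ 1` only gives
  -- positivity. Below, `κ` is the mean over a period, which makes `ψ` periodic.
  refine ⟨|∫ x in (0 : ℝ)..π, -log (cos x)| + 1, by positivity, fun ε hε hε1 => ?_⟩
  set K := |∫ x in (0 : ℝ)..π, -log (cos x)| + 1
  have hcont := continuous_logLoss hε
  have hint : ∀ a b, IntervalIntegrable (logLoss ε) volume a b := hcont.intervalIntegrable
  set Φ : ℝ → ℝ := fun x => ∫ u in (0 : ℝ)..x, logLoss ε u with hΦ
  have hmono : ∀ {x y}, x ≤ y → Φ x ≤ Φ y := by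
    intro x y hxy
    have := intervalIntegral.integral_nonneg (μ := volume) hxy
      (fun u _ => logLoss_nonneg hε hε1 u)
    have h := intervalIntegral.integral_interval_sub_left (hint 0 y) (hint 0 x)
    simp only [hΦ]
    linarith
  have hΦ0 : Φ 0 = 0 := by simp [hΦ]
  have hΦπ : Φ π ≤ K := by
    have hlog : IntervalIntegrable (fun x => -log (cos x)) volume 0 π :=
      (intervalIntegrable_log_cos (a := 0) (b := π)).neg
    have h : Φ π ≤ ∫ x in (0 : ℝ)..π, -log (cos x) := by
      refine intervalIntegral.integral_mono_ae_restrict pi_pos.le (hint _ _) hlog ?_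
      have hne : ∀ᵐ x : ℝ, x ≠ π / 2 := by
        simp [ae_iff]
      filter_upwards [ae_restrict_mem measurableSet_Icc, ae_restrict_of_ae hne] with x hx hx2
      refine logLoss_le hε fun h => hx2 ?_
      exact injOn_cos hx ⟨by positivity, by linarith [pi_pos]⟩ (by rw [h, cos_pi_div_two])
    exact h.trans ((le_abs_self _).trans (by simp [K]))
  have hκ0 : 0 ≤ Φ π / π := div_nonneg (hΦ0 ▸ hmono pi_pos.le) pi_pos.le
  have hper : Function.Periodic (fun x => Φ x - Φ π / π * x) π := by
    intro x
    have h1 := intervalIntegral.integral_add_adjacent_intervals (hint 0 x) (hint x (x + π))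
    have h2 := (periodic_logLoss ε).intervalIntegral_add_eq x 0
    rw [zero_add] at h2
    simp only [hΦ] at h1 ⊢
    rw [← h1, h2]
    field_simp
    ring
  refine ⟨Φ π / π, fun x => Φ x - Φ π / π * x, hκ0, ?_, fun x => ?_, fun x => ?_⟩
  · refine (div_le_self (hΦ0 ▸ hmono pi_pos.le) ?_).trans hΦπ
    linarith [pi_gt_three]
  · have h1 := intervalIntegral.integral_hasDerivAt_right (hint 0 x)
      hcont.stronglyMeasurable.stronglyMeasurableAtFilter hcont.continuousAt
    exact (h1.sub ((hasDerivAt_id x).const_mul (Φ π / π))).congr_deriv (by simp)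
  · obtain ⟨y, hy, hxy⟩ := hper.exists_mem_Ico₀ pi_pos x
    change |Φ x - Φ π / π * x| ≤ K
    rw [hxy]
    have h1 : 0 ≤ Φ y := hΦ0 ▸ hmono hy.1
    have h2 : Φ y ≤ Φ π := hmono hy.2.le
    have h3 : 0 ≤ Φ π / π * y := mul_nonneg hκ0 hy.1
    have h4 : Φ π / π * y ≤ Φ π := by
      calc Φ π / π * y ≤ Φ π / π * π := by gcongr; exact hy.2.le
        _ = Φ π := div_mul_cancel₀ _ pi_pos.ne'
    rw [abs_le]
    constructor <;> linarith

/-! ### Angles along curves on which the potential increases exponentially fast -/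

lemma hasDerivAt_arccot_sub {f : ℝ → ℝ} {f' s : ℝ} (t : ℝ) (hf : HasDerivAt f f' s) :
    HasDerivAt (fun s => arccot (t - f s)) (f' / ((t - f s) ^ 2 + 1)) s := by
  unfold arccot
  refine (((hf.const_sub t).arctan).const_sub (π / 2)).congr_deriv ?_
  rw [add_comm 1]
  ring

lemma abs_arccot_le (x : ℝ) : |arccot x| ≤ π := by
  have h1 := neg_pi_div_two_lt_arctan x
  have h2 := arctan_lt_pi_div_two x
  rw [arccot, abs_le]
  constructor <;> linarith [pi_pos]

/-- The potential enters the recursion twice: through `arccot`, giving `f' / g`, and through `τ`,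
whose derivative `2aτ f' / g` may have the wrong sign. -/
lemma hasDerivAt_angle_succ {f x : ℝ → ℝ} {f' x' s : ℝ} (t : ℝ) {l : ℝ} (hl : 0 < l)
    (hf : HasDerivAt f f' s) (hx : HasDerivAt x x' s) {a g τ : ℝ} (ha : a = t - f s)
    (hg : g = a ^ 2 + 1) (hτ : τ = 1 / (l ^ 2 * g)) :
    HasDerivAt (fun s => arccot (t - f s) +
        angleMap (1 / (l ^ 2 * ((t - f s) ^ 2 + 1))) (x s))
      (f' / g + (τ * x' + sin (x s) * cos (x s) * (2 * a * τ * (f' / g))) /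
        (cos (x s) ^ 2 + τ ^ 2 * sin (x s) ^ 2)) s := by
  have hτ' : HasDerivAt (fun s => 1 / (l ^ 2 * ((t - f s) ^ 2 + 1))) (2 * a * τ * (f' / g)) s := by
    have h1 : HasDerivAt (fun s => l ^ 2 * ((t - f s) ^ 2 + 1)) (l ^ 2 * (2 * a * -f')) s :=
      ((((hf.const_sub t).pow 2).add_const 1).const_mul (l ^ 2)).congr_deriv (by
        simp [ha])
    have h0 : l ^ 2 * ((t - f s) ^ 2 + 1) ≠ 0 := by positivity
    have h2 := (hasDerivAt_const s (1 : ℝ)).div h1 h0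
    refine h2.congr_deriv ?_
    rw [← ha, ← hg] at h0 ⊢
    have hg0 : g ≠ 0 := right_ne_zero_of_mul h0
    rw [hτ]
    field_simp
    ring
  have h3 := hasDerivAt_angleMap hτ' hx (by positivity)
  rw [← ha, ← hg, ← hτ] at h3
  have h4 := hasDerivAt_arccot_sub t hf
  rw [← ha, ← hg] at h4
  exact h4.add h3

lemma sq_add_one_le_ten {a : ℝ} (ha : |a| ≤ 3) : a ^ 2 + 1 ≤ 10 := by
  have h : a ^ 2 ≤ 3 ^ 2 := sq_le_sq.2 (by rwa [abs_of_pos (zero_lt_three' ℝ)])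
  linarith

lemma one_le_sq_add_one (a : ℝ) : 1 ≤ a ^ 2 + 1 := by
  linarith [sq_nonneg a]

/-- The derivative is `F/g · (1 + E) + τy/Δ`, with `E` the effect of the varying `τ` and `|E| ≤ 3`.
If `E ≥ -1/2`, the first term is at least `F/20`. Otherwise the vector is so close to the contracted
axis that `Δ = O(τ²)`, and the inherited rotation, at least `y/(145τ)`, outweighs a loss of at most
`2F`. -/
lemma angle_succ_deriv_bounds {a g τ S C F y b : ℝ} (hg : g = a ^ 2 + 1) (ha : |a| ≤ 3)
    (hτ : 0 < τ) (hτ1 : τ ≤ 1) (h : S ^ 2 + C ^ 2 = 1) (hF : 0 ≤ F) (hy : 0 ≤ y) (h1 : b ≤ F / 20)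
    (h2 : b + 2 * F ≤ y / (145 * τ)) :
    b ≤ F / g + (τ * y + S * C * (2 * a * τ * (F / g))) / (C ^ 2 + τ ^ 2 * S ^ 2) ∧
      F / g + (τ * y + S * C * (2 * a * τ * (F / g))) / (C ^ 2 + τ ^ 2 * S ^ 2) ≤
        4 * F + y / τ := by
  have hg1 : 1 ≤ g := hg ▸ one_le_sq_add_one a
  have hg10 : g ≤ 10 := hg ▸ sq_add_one_le_ten ha
  have hΔ1 : τ ^ 2 ≤ C ^ 2 + τ ^ 2 * S ^ 2 := by
    have h3 : 0 ≤ C ^ 2 * (1 - τ ^ 2) :=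
      mul_nonneg (sq_nonneg C) (sub_nonneg.2 (pow_le_one₀ hτ.le hτ1))
    linear_combination h3 - τ ^ 2 * h
  have hΔ : 0 < C ^ 2 + τ ^ 2 * S ^ 2 := lt_of_lt_of_le (by positivity) hΔ1
  set Δ := C ^ 2 + τ ^ 2 * S ^ 2 with hΔdef
  set E := 2 * a * τ * (S * C) / Δ with hE
  have hD : F / g + (τ * y + S * C * (2 * a * τ * (F / g))) / Δ =
      F / g * (1 + E) + τ * y / Δ := by
    rw [hE]; field_simp; ring
  have hEa : |E| ≤ 3 := by
    rw [hE, abs_div, abs_of_pos hΔ, div_le_iff₀ hΔ]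
    have h3 : |2 * a * τ * (S * C)| = |a| * (2 * (τ * |S|) * |C|) := by
      simp only [abs_mul, abs_of_pos hτ, abs_two]; ring
    have h4 : 2 * (τ * |S|) * |C| ≤ Δ := by
      have := two_mul_le_add_sq (τ * |S|) |C|
      rw [mul_pow, sq_abs, sq_abs] at this
      linarith
    rw [h3]
    exact mul_le_mul ha h4 (by positivity) (by norm_num)
  have hFg : F / g ≤ F := div_le_self hF hg1
  have hFg0 : 0 ≤ F / g := by positivity
  have hFg10 : F / 10 ≤ F / g := by gcongr
  have hE' := abs_le.1 hEa
  rw [hD]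
  constructor
  · have hyΔ : 0 ≤ τ * y / Δ := by positivity
    rcases le_total (-1 / 2) E with hcase | hcase
    · have h5 : F / 10 * (1 / 2) ≤ F / g * (1 + E) :=
        mul_le_mul hFg10 (by linarith) (by norm_num) hFg0
      linarith
    · have h5 : Δ ≤ 12 * τ * (|S| * |C|) := by
        have h6 : 2 * a * τ * (S * C) ≤ -1 / 2 * Δ := by
          rw [hE, div_le_iff₀ hΔ] at hcase; exact hcase
        have h7 : -(2 * a * τ * (S * C)) ≤ 6 * τ * (|S| * |C|) := by
          refine (neg_le_abs _).trans ?_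
          have h3 : |2 * a * τ * (S * C)| = |a| * (2 * τ * (|S| * |C|)) := by
            simp only [abs_mul, abs_of_pos hτ, abs_two]; ring
          rw [h3]
          have h4 : |a| * (2 * τ * (|S| * |C|)) ≤ 3 * (2 * τ * (|S| * |C|)) := by gcongr
          linarith
        linarith
      have hS1 : |S| ≤ 1 := by
        rw [← sq_le_one_iff_abs_le_one]; linarith [sq_nonneg C]
      have hC12 : |C| ≤ 12 * τ := by
        have h6 : |C| * |C| ≤ 12 * τ * |C| := by
          have h7 : |S| * |C| ≤ |C| := mul_le_of_le_one_left (abs_nonneg C) hS1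
          have h8 : |C| * |C| ≤ Δ := by
            rw [abs_mul_abs_self, hΔdef, ← mul_pow, ← sq]
            linarith [sq_nonneg (τ * S)]
          have h9 : 12 * τ * (|S| * |C|) ≤ 12 * τ * |C| := by gcongr
          linarith
        by_contra! hcon
        have : 0 < |C| := lt_trans (by positivity) hcon
        exact (le_of_mul_le_mul_right h6 this).not_gt hcon
      -- `145 = 12² + 1`.
      have hΔ145 : Δ ≤ 145 * τ ^ 2 := by
        have h6 : C ^ 2 ≤ (12 * τ) ^ 2 := by
          rw [← sq_abs C]; gcongr
        have h7 : τ ^ 2 * S ^ 2 ≤ τ ^ 2 * 1 := by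
          gcongr; linarith [sq_nonneg C]
        rw [hΔdef]
        linarith
      have h8 : y / (145 * τ) ≤ τ * y / Δ := by
        rw [div_le_div_iff₀ (by positivity) hΔ]
        linear_combination y * hΔ145
      have h9 : F / g * (-2) ≤ F / g * (1 + E) := by gcongr; linarith
      linarith
  · have h8 : τ * y / Δ ≤ y / τ := by
      rw [div_le_div_iff₀ hΔ hτ]
      linear_combination y * hΔ1
    have h9 : F / g * (1 + E) ≤ F / g * 4 := by gcongr; linarith
    linarith

/-- A sequence of functions on `[0,1]` whose `k`-th member increases at a rate comparable to `α ^ k`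
off a finite set with at most of the order of `α ^ k` points. -/
structure IsExpanding (α c M N : ℝ) (f : ℕ → ℝ → ℝ) (B : ℕ → Finset ℝ) : Prop where
  measurable : ∀ k, Measurable (f k)
  abs_le_one : ∀ k s, |f k s| ≤ 1
  subset_succ : ∀ k, B k ⊆ B (k + 1)
  card_le : ∀ k, ((B k).card + 1 : ℝ) ≤ N * α ^ k
  exists_hasDerivAt : ∀ k, ∀ s ∈ Set.Ioo (0 : ℝ) 1, s ∉ B k →
    ∃ d, HasDerivAt (f k) d s ∧ c * α ^ k ≤ d ∧ d ≤ M * α ^ k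

namespace IsExpanding

variable {α c M N t l : ℝ} {f : ℕ → ℝ → ℝ} {B : ℕ → Finset ℝ}

lemma exists_hasDerivAt_pruferAngle (hf : IsExpanding α c M N f B) (hα : 2 ≤ α) (hα3 : α ≤ 3)
    (hc : 0 < c) (hcM : c ≤ M) (ht : t ∈ Set.Icc (-1 : ℝ) 2) (hl1 : 1 ≤ l)
    (hl : 435 * (1 + 40 * M / c) ≤ l ^ 2) (k : ℕ) :
    ∃ H, ∀ s ∈ Set.Ioo (0 : ℝ) 1, s ∉ B k →
      ∃ d, HasDerivAt (fun s => pruferAngle t l (fun j => f j s) k) d s ∧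
        c / 20 * α ^ k ≤ d ∧ d ≤ H := by
  have hα0 : 0 < α := by linarith
  have hM : 0 < M := hc.trans_le hcM
  have hl0 : 0 < l := by linarith
  have ha : ∀ k s, |t - f k s| ≤ 3 := by
    intro k s
    have := abs_le.1 (hf.abs_le_one k s)
    rw [abs_le]
    constructor <;> linarith [ht.1, ht.2]
  induction k with
  | zero =>
    refine ⟨M, fun s hs hsB => ?_⟩
    obtain ⟨d, hd, hd1, hd2⟩ := hf.exists_hasDerivAt 0 s hs hsB
    refine ⟨_, hasDerivAt_arccot_sub t hd, ?_, ?_⟩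
    · have hg10 : (t - f 0 s) ^ 2 + 1 ≤ 20 :=
      (sq_add_one_le_ten (ha 0 s)).trans (by norm_num)
      rw [le_div_iff₀ (by positivity)]
      simp only [pow_zero, mul_one] at hd1 ⊢
      have h1 : c / 20 * ((t - f 0 s) ^ 2 + 1) ≤ c / 20 * 20 := by gcongr
      linarith
    · simp only [pow_zero, mul_one] at hd1 hd2
      refine (div_le_self (by linarith) ?_).trans hd2
      exact one_le_sq_add_one _
  | succ k ih =>
    obtain ⟨H, hH⟩ := ih
    -- The upper bound deteriorates with `k` and `l`; it serves only for integrability.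
    refine ⟨4 * (M * α ^ (k + 1)) + H * (10 * l ^ 2), fun s hs hsB => ?_⟩
    obtain ⟨y, hy, hy1, hy2⟩ := hH s hs fun h => hsB (hf.subset_succ k h)
    obtain ⟨d, hd, hd1, hd2⟩ := hf.exists_hasDerivAt (k + 1) s hs hsB
    set a := t - f (k + 1) s with hadef
    set g := a ^ 2 + 1 with hg
    set τ := 1 / (l ^ 2 * g) with hτ
    have hg1 : 1 ≤ g := hg ▸ one_le_sq_add_one a
    have hg10 : g ≤ 10 := sq_add_one_le_ten (ha (k + 1) s)
    have hg0 : 0 < g := by linarith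
    have hτ0 : 0 < τ := by positivity
    have hτinv : 1 / τ = l ^ 2 * g := by rw [hτ, one_div_one_div]
    have hτ1 : τ ≤ 1 := by
      rw [hτ, div_le_one (by positivity)]
      exact one_le_mul_of_one_le_of_one_le (one_le_pow₀ hl1) hg1
    have hy0 : 0 ≤ y := le_trans (by positivity) hy1
    have hd0 : 0 ≤ d := le_trans (by positivity) hd1
    have hb := angle_succ_deriv_bounds (b := c / 20 * α ^ (k + 1)) hg (ha (k + 1) s) hτ0 hτ1
      (sin_sq_add_cos_sq (pruferAngle t l (fun j => f j s) k)) hd0 hy0 (by linarith) (by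
        have h1 : y / (145 * τ) = y * (l ^ 2 * g) / 145 := by
          rw [← hτinv]; field_simp
        -- `435 = 3 · 145`, the factor `3` coming from `α ≤ 3`; this is the origin of the threshold
        -- on `l`.
        have h2 : 435 * (c / 20 + 2 * M) ≤ c / 20 * l ^ 2 := by
          have h3 : 435 * (1 + 40 * M / c) * (c / 20) ≤ l ^ 2 * (c / 20) := by gcongr
          have h4 : 435 * (1 + 40 * M / c) * (c / 20) = 435 * (c / 20 + 2 * M) := by
            field_simp; ring
          linarith
        have h5 : c / 20 * α ^ k * (l ^ 2 * 1) ≤ y * (l ^ 2 * g) := by gcongr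
        have hk : 0 < α ^ k := by positivity
        have h6 : α ^ (k + 1) ≤ 3 * α ^ k := by
          rw [pow_succ, mul_comm]; gcongr
        have h7 : (c / 20 + 2 * M) * α ^ (k + 1) ≤ (c / 20 + 2 * M) * (3 * α ^ k) := by gcongr
        have h8 := mul_le_mul_of_nonneg_right h2 hk.le
        rw [h1]
        linarith)
    refine ⟨_, hasDerivAt_angle_succ t hl0 hd hy hadef hg hτ, hb.1, hb.2.trans ?_⟩
    have h1 : y / τ ≤ H * (10 * l ^ 2) := by
      rw [div_eq_mul_one_div, hτinv]
      have : l ^ 2 * g ≤ 10 * l ^ 2 := by rw [mul_comm]; gcongr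
      exact mul_le_mul hy2 this (by positivity) (hy0.trans hy2)
    linarith

end IsExpanding

/-! ### Total growth of the angle and mean loss on a segment -/

lemma measurable_pruferAngle {X : Type*} [MeasurableSpace X] (t l : ℝ) {a : X → ℕ → ℝ}
    (ha : ∀ j, Measurable fun x => a x j) (k : ℕ) :
    Measurable fun x => pruferAngle t l (a x) k := by
  induction k with
  | zero =>
    have := ha 0
    simp only [pruferAngle, arccot]
    fun_prop
  | succ k ih =>
    have := ha (k + 1)
    simp only [pruferAngle, arccot, angleMap]
    fun_prop

lemma abs_pruferAngle_succ_sub_le (t l : ℝ) (a : ℕ → ℝ) (k : ℕ) :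
    |pruferAngle t l a (k + 1) - pruferAngle t l a k| ≤ 3 / 2 * π := by
  have h1 := abs_arccot_le (t - a (k + 1))
  have h2 := abs_angleMap_sub_self_le (1 / (l ^ 2 * ((t - a (k + 1)) ^ 2 + 1))) (pruferAngle t l a k)
  rw [pruferAngle, add_sub_assoc]
  refine (abs_add_le _ _).trans ?_
  linarith

namespace IsExpanding

variable {α c M N t l : ℝ} {f : ℕ → ℝ → ℝ} {B : ℕ → Finset ℝ}

lemma deriv_pruferAngle_bounds (hf : IsExpanding α c M N f B) (hα : 2 ≤ α) (hα3 : α ≤ 3)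
    (hc : 0 < c) (hcM : c ≤ M) (ht : t ∈ Set.Icc (-1 : ℝ) 2) (hl1 : 1 ≤ l)
    (hl : 435 * (1 + 40 * M / c) ≤ l ^ 2) (k : ℕ) :
    ∃ H, ∀ s ∈ Set.Ioo (0 : ℝ) 1, s ∉ B k →
      HasDerivAt (fun s => pruferAngle t l (fun j => f j s) k)
        (deriv (fun s => pruferAngle t l (fun j => f j s) k) s) s ∧
      c / 20 * α ^ k ≤ deriv (fun s => pruferAngle t l (fun j => f j s) k) s ∧
      deriv (fun s => pruferAngle t l (fun j => f j s) k) s ≤ H := by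
  obtain ⟨H, hH⟩ := hf.exists_hasDerivAt_pruferAngle hα hα3 hc hcM ht hl1 hl k
  refine ⟨H, fun s hs hsB => ?_⟩
  obtain ⟨d, hd, hd1, hd2⟩ := hH s hs hsB
  rw [hd.deriv]
  exact ⟨hd, hd1, hd2⟩

lemma ae_mem_Ioo_notMem (B : Finset ℝ) :
    ∀ᵐ s ∂(volume.restrict (Set.Ioc (0 : ℝ) 1)), s ∈ Set.Ioo (0 : ℝ) 1 ∧ s ∉ B := by
  have h1 : ∀ᵐ s : ℝ, s ∉ insert 1 B :=
    (Finset.countable_toSet _).ae_notMem volume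
  filter_upwards [ae_restrict_mem measurableSet_Ioc, ae_restrict_of_ae h1] with s hs hs1
  simp only [Finset.mem_insert, not_or] at hs1
  exact ⟨⟨hs.1, lt_of_le_of_ne hs.2 hs1.1⟩, hs1.2⟩

lemma intervalIntegrable_deriv_pruferAngle (hf : IsExpanding α c M N f B) (hα : 2 ≤ α)
    (hα3 : α ≤ 3) (hc : 0 < c) (hcM : c ≤ M) (ht : t ∈ Set.Icc (-1 : ℝ) 2) (hl1 : 1 ≤ l)
    (hl : 435 * (1 + 40 * M / c) ≤ l ^ 2) (k : ℕ) :
    IntervalIntegrable (deriv fun s => pruferAngle t l (fun j => f j s) k) volume 0 1 := by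
  obtain ⟨H, hH⟩ := hf.deriv_pruferAngle_bounds hα hα3 hc hcM ht hl1 hl k
  rw [intervalIntegrable_iff_integrableOn_Ioc_of_le zero_le_one]
  refine Measure.integrableOn_of_bounded (M := H) (by simp)
    (measurable_deriv _).aestronglyMeasurable ?_
  filter_upwards [ae_mem_Ioo_notMem (B k)] with s hs
  obtain ⟨-, h1, h2⟩ := hH s hs.1 hs.2
  rwa [norm_eq_abs, abs_of_nonneg (le_trans (by positivity) h1)]

/-- Telescoping in time: the increment is bounded by `3π/2`, so passing to `k + 1` adds at most
`3πNα^(k+1)`. Since `α ≥ 2`, the previous bound `6πNα^k` is at most `3πNα^(k+1)` too, and the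
induction closes. -/
lemma integral_deriv_pruferAngle_le (hf : IsExpanding α c M N f B) (hα : 2 ≤ α) (hα3 : α ≤ 3)
    (hc : 0 < c) (hcM : c ≤ M) (ht : t ∈ Set.Icc (-1 : ℝ) 2) (hl1 : 1 ≤ l)
    (hl : 435 * (1 + 40 * M / c) ≤ l ^ 2) (k : ℕ) :
    ∫ s in (0 : ℝ)..1, deriv (fun s => pruferAngle t l (fun j => f j s) k) s ≤
      6 * π * (N * α ^ k) := by
  have hint := hf.intervalIntegrable_deriv_pruferAngle hα hα3 hc hcM ht hl1 hl
  have hder : ∀ k, ∀ s ∈ Set.Ioo (0 : ℝ) 1, s ∉ B k →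
      HasDerivAt (fun s => pruferAngle t l (fun j => f j s) k)
        (deriv (fun s => pruferAngle t l (fun j => f j s) k) s) s := fun k s hs hsB => by
    obtain ⟨H, hH⟩ := hf.deriv_pruferAngle_bounds hα hα3 hc hcM ht hl1 hl k
    exact (hH s hs hsB).1
  have hN : ∀ k, 0 ≤ N * α ^ k := fun k => le_trans (by positivity) (hf.card_le k)
  induction k with
  | zero =>
    refine (integral_deriv_le_of_finite_exceptions (K := π) (fun s => abs_arccot_le (t - f 0 s))
      (B 0) zero_le_one (hder 0) (hint 0)).trans ?_
    have h1 := mul_le_mul_of_nonneg_left (hf.card_le 0) pi_pos.le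
    have h2 := mul_nonneg pi_pos.le (hN 0)
    linarith
  | succ k ih =>
    have h1 := integral_deriv_le_of_finite_exceptions
      (fun s => abs_pruferAngle_succ_sub_le t l (fun j => f j s) k) (B (k + 1)) zero_le_one
      (fun s hs hsB => (hder (k + 1) s hs hsB).sub
        (hder k s hs fun h => hsB (hf.subset_succ k h))) ((hint (k + 1)).sub (hint k))
    rw [intervalIntegral.integral_sub (hint (k + 1)) (hint k)] at h1
    have h2 := mul_le_mul_of_nonneg_left (hf.card_le (k + 1)) pi_pos.le
    have h3 : 2 * (N * α ^ k) ≤ N * α ^ (k + 1) := by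
      have := mul_le_mul_of_nonneg_right hα (hN k)
      rw [pow_succ]
      linarith
    have h4 := mul_le_mul_of_nonneg_left h3 pi_pos.le
    linarith

/-- The mean logarithmic loss is bounded independently of the time. -/
lemma integral_logLoss_le (hf : IsExpanding α c M N f B) (hα : 2 ≤ α) (hα3 : α ≤ 3)
    (hc : 0 < c) (hcM : c ≤ M) (ht : t ∈ Set.Icc (-1 : ℝ) 2) (hl1 : 1 ≤ l)
    (hl : 435 * (1 + 40 * M / c) ≤ l ^ 2) {K ε κ : ℝ} {ψ : ℝ → ℝ} (hε : 0 < ε) (hε1 : ε ≤ 1)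
    (hκ : 0 ≤ κ) (hκK : κ ≤ K) (hψ : ∀ x, HasDerivAt ψ (logLoss ε x - κ) x)
    (hψK : ∀ x, |ψ x| ≤ K) (k : ℕ) :
    ∫ s in (0 : ℝ)..1, logLoss ε (pruferAngle t l (fun j => f j s) k) ≤
      20 * (2 * K + 6 * π * K) * N / c := by
  set x : ℝ → ℝ := fun s => pruferAngle t l (fun j => f j s) k with hx
  obtain ⟨H, hH⟩ := hf.deriv_pruferAngle_bounds hα hα3 hc hcM ht hl1 hl k
  have hint : IntervalIntegrable (deriv x) volume 0 1 :=
    hf.intervalIntegrable_deriv_pruferAngle hα hα3 hc hcM ht hl1 hl k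
  have hW : ∫ s in (0 : ℝ)..1, deriv x s ≤ 6 * π * (N * α ^ k) :=
    hf.integral_deriv_pruferAngle_le hα hα3 hc hcM ht hl1 hl k
  have hxm : Measurable x := measurable_pruferAngle t l hf.measurable k
  have hqm : Measurable fun s => logLoss ε (x s) := (continuous_logLoss hε).measurable.comp hxm
  have hqb : ∀ s, ‖logLoss ε (x s)‖ ≤ -(1 / 2 * log ε) := fun s => by
    rw [norm_eq_abs, abs_of_nonneg (logLoss_nonneg hε hε1 _)]
    exact logLoss_le_log hε hε1 _
  have hqi : IntervalIntegrable (fun s => logLoss ε (x s)) volume 0 1 := by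
    rw [intervalIntegrable_iff_integrableOn_Ioc_of_le zero_le_one]
    exact Measure.integrableOn_of_bounded (by simp) hqm.aestronglyMeasurable (ae_of_all _ hqb)
  have hqxi : IntervalIntegrable (fun s => logLoss ε (x s) * deriv x s) volume 0 1 := by
    rw [intervalIntegrable_iff_integrableOn_Ioc_of_le zero_le_one] at hint ⊢
    exact hint.bdd_mul hqm.aestronglyMeasurable (ae_of_all _ hqb)
  have hα0 : 0 < α := by linarith
  have hK : 0 ≤ K := hκ.trans hκK
  have h1 := integral_deriv_le_of_finite_exceptions (ψ := fun s => ψ (x s))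
    (ψ' := fun s => logLoss ε (x s) * deriv x s - κ * deriv x s)
    (fun s => hψK (x s)) (B k) zero_le_one
    (fun s hs hsB => ((hψ (x s)).comp s (hH s hs hsB).1).congr_deriv (sub_mul _ _ _))
    (hqxi.sub (hint.const_mul κ))
  rw [intervalIntegral.integral_sub hqxi (hint.const_mul κ),
    intervalIntegral.integral_const_mul] at h1
  -- Nonnegativity of the loss allows `x'` to be replaced by its lower bound.
  have h2 : ∫ s in (0 : ℝ)..1, c / 20 * α ^ k * logLoss ε (x s) ≤
      ∫ s in (0 : ℝ)..1, logLoss ε (x s) * deriv x s := by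
    refine intervalIntegral.integral_mono_ae_restrict zero_le_one (hqi.const_mul _) hqxi ?_
    rw [← restrict_Ioc_eq_restrict_Icc]
    filter_upwards [ae_mem_Ioo_notMem (B k)] with s hs
    rw [mul_comm]
    exact mul_le_mul_of_nonneg_left (hH s hs.1 hs.2).2.1 (logLoss_nonneg hε hε1 _)
  rw [intervalIntegral.integral_const_mul] at h2
  have h3 : 2 * K * ((B k).card + 1) ≤ 2 * K * (N * α ^ k) := by
    gcongr; exact hf.card_le k
  have hNk : 0 ≤ 6 * π * (N * α ^ k) :=
    mul_nonneg (by positivity) (le_trans (by positivity) (hf.card_le k))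
  have h4 : κ * ∫ s in (0 : ℝ)..1, deriv x s ≤ K * (6 * π * (N * α ^ k)) :=
    (mul_le_mul_of_nonneg_left hW hκ).trans (mul_le_mul_of_nonneg_right hκK hNk)
  rw [le_div_iff₀ hc]
  have hk : 0 < α ^ k := by positivity
  refine le_of_mul_le_mul_right ?_ hk
  linarith

end IsExpanding

/-! ### The potential along unstable segments -/

/-- The projection of the plane onto the torus. -/
def toTorus (p : ℝ × ℝ) : Torus := ((p.1 : UnitAddCircle), (p.2 : UnitAddCircle))

/-- The unstable eigenvalue of the cat map. -/
def unstableEigenvalue : ℝ := (3 + √5) / 2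

lemma two_le_unstableEigenvalue : 2 ≤ unstableEigenvalue := by
  have h : (2 : ℝ) ≤ √5 := le_sqrt_of_sq_le (by norm_num)
  unfold unstableEigenvalue
  linarith

lemma unstableEigenvalue_le_three : unstableEigenvalue ≤ 3 := by
  have h : √5 ≤ 3 := sqrt_le_iff.2 (by norm_num)
  unfold unstableEigenvalue
  linarith

lemma toTorus_surjective : Function.Surjective toTorus := by
  rintro ⟨x, y⟩
  obtain ⟨a, rfl⟩ := QuotientAddGroup.mk_surjective x
  obtain ⟨b, rfl⟩ := QuotientAddGroup.mk_surjective y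
  exact ⟨(a, b), rfl⟩

lemma toTorus_add (p q : ℝ × ℝ) : toTorus (p + q) = toTorus p + toTorus q := rfl

lemma continuous_toTorus : Continuous toTorus := by
  unfold toTorus
  exact ((AddCircle.continuous_mk' 1).comp continuous_fst).prodMk
    ((AddCircle.continuous_mk' 1).comp continuous_snd)

lemma toTorus_intCast (m n : ℤ) : toTorus ((m : ℝ), (n : ℝ)) = 0 := by
  have h : ∀ k : ℤ, ((k : ℝ) : UnitAddCircle) = 0 := fun k =>
    (AddCircle.coe_eq_zero_iff 1).2 ⟨k, by simp⟩
  simp only [toTorus, h]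
  rfl

lemma catMap_add (ω η : Torus) : catMap (ω + η) = catMap ω + catMap η := by
  simp only [catMap, Prod.fst_add, Prod.snd_add, smul_add, Prod.mk_add_mk]
  congr 1 <;> abel

lemma catMap_toTorus_smul (s : ℝ) :
    catMap (toTorus (s • unstableVector)) = toTorus ((unstableEigenvalue * s) • unstableVector) := by
  have h5 : √5 * √5 = 5 := mul_self_sqrt (by norm_num)
  simp only [catMap, toTorus, unstableVector, unstableEigenvalue, Prod.smul_mk, smul_eq_mul,
    ← AddCircle.coe_nsmul, ← AddCircle.coe_add, nsmul_eq_mul]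
  congr 2
  · push_cast
    linear_combination (-s / 4) * h5
  · ring

lemma catMap_iterate_add_toTorus (ω : Torus) (s : ℝ) (k : ℕ) :
    catMap^[k] (ω + toTorus (s • unstableVector)) =
      catMap^[k] ω + toTorus ((unstableEigenvalue ^ k * s) • unstableVector) := by
  induction k with
  | zero => simp
  | succ k ih =>
    rw [Function.iterate_succ_apply', ih, catMap_add, catMap_toTorus_smul,
      ← Function.iterate_succ_apply' catMap, pow_succ', mul_assoc]

/-- The parameters in `[0, 1]` at which the affine function `s ↦ p + β s` takes integer values. -/
def integerTimes (β p : ℝ) : Finset ℝ :=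
  (Finset.Icc ⌈p⌉ ⌊p + β⌋).image fun m : ℤ => ((m : ℝ) - p) / β

lemma card_integerTimes_le {β : ℝ} (hβ : 0 < β) (p : ℝ) :
    ((integerTimes β p).card : ℝ) ≤ β + 1 := by
  have h1 : ((integerTimes β p).card : ℝ) ≤ ((Finset.Icc ⌈p⌉ ⌊p + β⌋).card : ℝ) := by
    exact_mod_cast Finset.card_image_le
  refine h1.trans ?_
  rw [Int.card_Icc]
  have h2 : ((⌊p + β⌋ + 1 - ⌈p⌉ : ℤ) : ℝ) ≤ β + 1 := by
    push_cast
    linarith [Int.floor_le (p + β), Int.le_ceil p]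
  rcases le_total 0 (⌊p + β⌋ + 1 - ⌈p⌉) with h | h
  · have h3 : (((⌊p + β⌋ + 1 - ⌈p⌉).toNat : ℤ) : ℝ) = ((⌊p + β⌋ + 1 - ⌈p⌉ : ℤ) : ℝ) := by
      rw [Int.toNat_of_nonneg h]
    rw [Int.cast_natCast] at h3
    rw [h3]
    exact h2
  · rw [Int.toNat_of_nonpos h]
    simpa using by linarith

lemma mem_integerTimes {β p s : ℝ} (hβ : 0 < β) (hs : s ∈ Set.Ioo (0 : ℝ) 1) {m : ℤ}
    (hm : p + β * s = m) : s ∈ integerTimes β p := by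
  rw [integerTimes, Finset.mem_image]
  refine ⟨m, Finset.mem_Icc.2 ⟨Int.ceil_le.2 ?_, Int.le_floor.2 ?_⟩, ?_⟩
  · rw [← hm]; nlinarith [mul_pos hβ hs.1]
  · rw [← hm]; nlinarith [mul_le_mul_of_nonneg_left hs.2.le hβ.le]
  · rw [← hm]; field_simp; ring

/-- Off the integer times neither coordinate is an integer, so an integer translation moves the
point into the open square, where `fderivWithin` is the full derivative. -/
lemma hasDerivAt_lift_line {v : Torus → ℝ} (hv : IsAdmissiblePotential v) {c M : ℝ}
    (hc : ∀ p ∈ unitSquare, c < unstableDeriv v p) (hM : ∀ p ∈ unitSquare, unstableDeriv v p ≤ M)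
    {β : ℝ} (hβ : 0 < β) (q : ℝ × ℝ) {s : ℝ} (hs : s ∈ Set.Ioo (0 : ℝ) 1)
    (h1 : s ∉ integerTimes (β * unstableVector.1) q.1)
    (h2 : s ∉ integerTimes (β * unstableVector.2) q.2) :
    ∃ d, HasDerivAt (fun s => v (toTorus q + toTorus ((β * s) • unstableVector))) d s ∧
      c * β ≤ d ∧ d ≤ M * β := by
  set p := q + (β * s) • unstableVector with hp
  set n : ℝ × ℝ := (((-⌊p.1⌋ : ℤ) : ℝ), ((-⌊p.2⌋ : ℤ) : ℝ)) with hn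
  have hu1 : 0 < unstableVector.1 := by simp only [unstableVector]; positivity
  have hu2 : 0 < unstableVector.2 := by simp [unstableVector]
  have hp1 : 0 < Int.fract p.1 := by
    refine (Int.fract_nonneg _).lt_of_ne' fun h => h1 ?_
    refine mem_integerTimes (by positivity) hs (m := ⌊p.1⌋) ?_
    rw [← sub_eq_zero, ← h, Int.fract, hp]
    simp only [Prod.fst_add, Prod.smul_fst, smul_eq_mul]
    ring
  have hp2 : 0 < Int.fract p.2 := by
    refine (Int.fract_nonneg _).lt_of_ne' fun h => h2 ?_
    refine mem_integerTimes (by positivity) hs (m := ⌊p.2⌋) ?_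
    rw [← sub_eq_zero, ← h, Int.fract, hp]
    simp only [Prod.snd_add, Prod.smul_snd, smul_eq_mul]
    ring
  have hpn : p + n = (Int.fract p.1, Int.fract p.2) := by
    ext <;> simp [hn, Int.fract, sub_eq_add_neg]
  have hmem : p + n ∈ unitSquare := by
    rw [hpn]
    exact ⟨⟨hp1.le, Int.fract_lt_one _⟩, ⟨hp2.le, Int.fract_lt_one _⟩⟩
  have hnhds : unitSquare ∈ nhds (p + n) := by
    rw [hpn]
    exact prod_mem_nhds (Ico_mem_nhds hp1 (Int.fract_lt_one _))
      (Ico_mem_nhds hp2 (Int.fract_lt_one _))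
  have hd : HasFDerivAt (lift v) (fderiv ℝ (lift v) (p + n)) (p + n) :=
    ((hv.contDiffOn.contDiffAt hnhds).differentiableAt (by norm_num)).hasFDerivAt
  have hcurve : HasDerivAt (fun s : ℝ => q + (β * s) • unstableVector + n)
      (β • unstableVector) s :=
    ((((((hasDerivAt_id s).const_mul β).smul_const unstableVector)).const_add q).add_const
      n).congr_deriv (by simp)
  have heq : (fun s => v (toTorus q + toTorus ((β * s) • unstableVector))) =
      fun s => lift v (q + (β * s) • unstableVector + n) := by
    funext s
    rw [← toTorus_add]
    change _ = v (toTorus (_ + n))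
    rw [toTorus_add _ n, hn, toTorus_intCast, add_zero]
  have hval : fderiv ℝ (lift v) (p + n) (β • unstableVector) = unstableDeriv v (p + n) * β := by
    rw [unstableDeriv, fderivWithin_of_mem_nhds hnhds, map_smul, smul_eq_mul, mul_comm]
  have hcomp : HasDerivAt (lift v ∘ fun s => q + (β * s) • unstableVector + n)
      (fderiv ℝ (lift v) (p + n) (β • unstableVector)) s := hd.comp_hasDerivAt s hcurve
  rw [heq]
  refine ⟨_, hcomp, ?_, ?_⟩
  · rw [hval]
    exact mul_le_mul_of_nonneg_right (hc _ hmem).le hβ.le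
  · rw [hval]
    exact mul_le_mul_of_nonneg_right (hM _ hmem) hβ.le

lemma continuous_catMap : Continuous catMap := by
  unfold catMap
  fun_prop

/-- The exceptional set collects all crossings up to time `k`, since the angle depends on the whole
past. Time `j` contributes at most `3α^j + 2 ≤ 5α^j`, and a geometric sum with `α ≥ 2` gives `11`.
-/
lemma exists_isExpanding {v : Torus → ℝ} (hv : IsAdmissiblePotential v) {c M : ℝ}
    (hc : ∀ p ∈ unitSquare, c < unstableDeriv v p) (hM : ∀ p ∈ unitSquare, unstableDeriv v p ≤ M)
    (ω : Torus) :
    ∃ B, IsExpanding unstableEigenvalue c M 11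
      (fun k s => v (catMap^[k] (ω + toTorus (s • unstableVector)))) B := by
  have hα := two_le_unstableEigenvalue
  have hα0 : 0 < unstableEigenvalue := by linarith
  choose Q hQ using fun k => toTorus_surjective (catMap^[k] ω)
  set E : ℕ → Finset ℝ := fun j =>
    integerTimes (unstableEigenvalue ^ j * unstableVector.1) (Q j).1 ∪
      integerTimes (unstableEigenvalue ^ j * unstableVector.2) (Q j).2 with hE
  have hcardE : ∀ j, ((E j).card : ℝ) ≤ 5 * unstableEigenvalue ^ j := by
    intro j
    have hu1 : 0 < unstableVector.1 := by simp only [unstableVector]; positivity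
    have hu2 : unstableVector.2 = 1 := rfl
    have hu : unstableVector.1 ≤ 2 := by
      have h : √5 ≤ 3 := sqrt_le_iff.2 (by norm_num)
      simp only [unstableVector]
      linarith
    have h1 : ((E j).card : ℝ) ≤
        ((integerTimes (unstableEigenvalue ^ j * unstableVector.1) (Q j).1).card +
          (integerTimes (unstableEigenvalue ^ j * unstableVector.2) (Q j).2).card : ℕ) := by
      exact_mod_cast Finset.card_union_le _ _
    have hj : 1 ≤ unstableEigenvalue ^ j := one_le_pow₀ (by linarith)
    have h2 := card_integerTimes_le (β := unstableEigenvalue ^ j * unstableVector.1)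
      (by positivity) (Q j).1
    have h3 := card_integerTimes_le (β := unstableEigenvalue ^ j * unstableVector.2)
      (by rw [hu2]; positivity) (Q j).2
    have h4 : unstableEigenvalue ^ j * unstableVector.1 ≤ unstableEigenvalue ^ j * 2 := by gcongr
    rw [hu2] at h3 h1
    push_cast at h1
    linarith
  refine ⟨fun k => (Finset.range (k + 1)).biUnion E, ⟨fun k => ?_, fun k s => hv.abs_le_one _,
    fun k => ?_, fun k => ?_, fun k s hs hsB => ?_⟩⟩
  · refine hv.measurable.comp (Continuous.measurable ?_)
    exact (continuous_catMap.iterate k).comp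
      (continuous_const.add (continuous_toTorus.comp (by fun_prop)))
  · exact Finset.biUnion_subset_biUnion_of_subset_left _
      (Finset.range_subset_range.2 (Nat.le_succ _))
  · have h1 : (((Finset.range (k + 1)).biUnion E).card : ℝ) ≤
        ∑ j ∈ Finset.range (k + 1), 5 * unstableEigenvalue ^ j :=
      le_trans (by exact_mod_cast Finset.card_biUnion_le) (Finset.sum_le_sum fun j _ => hcardE j)
    have h2 : ∀ k : ℕ, ∑ j ∈ Finset.range (k + 1), 5 * unstableEigenvalue ^ j + 1 ≤
        11 * unstableEigenvalue ^ k := by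
      intro k
      induction k with
      | zero => norm_num
      | succ k ih =>
        rw [Finset.sum_range_succ, pow_succ]
        have hk : 0 < unstableEigenvalue ^ k := by positivity
        nlinarith
    linarith [h2 k]
  · have hsE : s ∉ E k := fun h =>
      hsB (Finset.mem_biUnion.2 ⟨k, Finset.self_mem_range_succ k, h⟩)
    simp only [hE, Finset.mem_union, not_or] at hsE
    simp only [catMap_iterate_add_toTorus, ← hQ]
    exact hasDerivAt_lift_line hv hc hM (by positivity) (Q k) hs hsE.1 hsE.2

/-! ### Measure theory on the torus -/

instance isAddHaarMeasure_volume_torus : (volume : Measure Torus).IsAddHaarMeasure :=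
  Measure.prod.instIsAddHaarMeasure _ _

instance isProbabilityMeasure_volume_torus : IsProbabilityMeasure (volume : Measure Torus) where
  measure_univ := by
    rw [Measure.volume_eq_prod, ← Set.univ_prod_univ, Measure.prod_prod]
    simp

lemma measurePreserving_catMap : MeasurePreserving catMap volume volume := by
  let T : Torus →+ Torus := ⟨⟨catMap, by simp [catMap]⟩, catMap_add⟩
  have hsurj : Function.Surjective T := by
    rintro ⟨a, b⟩
    refine ⟨(a - b, 2 • b - a), ?_⟩
    change catMap _ = _
    simp only [catMap]
    congr 1 <;> abel
  exact T.measurePreserving continuous_catMap hsurj rfl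

/-- Each translate of `F` has the same integral, so averaging over `s` and exchanging the integrals
suffices. -/
lemma integral_le_of_integral_unstable_le {F : Torus → ℝ} (hF : Measurable F) {R C : ℝ}
    (hR : ∀ ω, ‖F ω‖ ≤ R)
    (h : ∀ ω, ∫ s in (0 : ℝ)..1, F (ω + toTorus (s • unstableVector)) ≤ C) :
    ∫ ω, F ω ≤ C := by
  have hm : Measurable fun p : Torus × ℝ => F (p.1 + toTorus (p.2 • unstableVector)) :=
    hF.comp (continuous_fst.add (continuous_toTorus.comp (by fun_prop))).measurable
  have hint : Integrable (Function.uncurry fun (ω : Torus) (s : ℝ) =>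
      F (ω + toTorus (s • unstableVector))) (volume.prod (volume.restrict (Set.Ioc (0 : ℝ) 1))) :=
    Integrable.of_bound hm.aestronglyMeasurable R (ae_of_all _ fun p => hR _)
  have h1 : ∫ ω, F ω =
      ∫ ω, ∫ s in Set.Ioc (0 : ℝ) 1, F (ω + toTorus (s • unstableVector)) := by
    rw [integral_integral_swap hint]
    simp only [integral_add_right_eq_self]
    simp
  have h2 : ∫ _ω : Torus, C = C := by simp
  rw [h1, ← h2]
  refine integral_mono hint.integral_prod_left (integrable_const C) fun ω => ?_
  have := h ω
  rwa [intervalIntegral.integral_of_le zero_le_one] at this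

/-! ### The operator norm on the Euclidean plane -/

/-- The embedding of arrays into the operators of the Euclidean plane. -/
def arrayToCLM : (Fin 2 → Fin 2 → ℝ) →ₗ[ℝ]
    (EuclideanSpace ℝ (Fin 2) →L[ℝ] EuclideanSpace ℝ (Fin 2)) where
  toFun m := Matrix.toEuclideanCLM (𝕜 := ℝ) (Matrix.of m)
  map_add' m n := map_add (Matrix.toEuclideanCLM (𝕜 := ℝ)) (Matrix.of m) (Matrix.of n)
  map_smul' a m := map_smul (Matrix.toEuclideanCLM (𝕜 := ℝ)) a (Matrix.of m)

lemma measurable_norm_toEuclideanCLM {X : Type*} [MeasurableSpace X]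
    {A : X → Matrix (Fin 2) (Fin 2) ℝ} (hA : ∀ i j, Measurable fun x => A x i j) :
    Measurable fun x => ‖Matrix.toEuclideanCLM (𝕜 := ℝ) (A x)‖ := by
  have h1 : Continuous fun m => ‖arrayToCLM m‖ :=
    arrayToCLM.continuous_of_finiteDimensional.norm
  have h2 : Measurable fun x => (fun i j => A x i j : Fin 2 → Fin 2 → ℝ) :=
    measurable_pi_iff.2 fun i => measurable_pi_iff.2 fun j => hA i j
  exact h1.measurable.comp h2

lemma exists_norm_toEuclideanCLM_le {K : ℝ} (hK : 0 ≤ K) :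
    ∃ R, ∀ A : Matrix (Fin 2) (Fin 2) ℝ, (∀ i j, |A i j| ≤ K) →
      ‖Matrix.toEuclideanCLM (𝕜 := ℝ) A‖ ≤ R := by
  refine ⟨‖LinearMap.toContinuousLinearMap arrayToCLM‖ * K, fun A hA => ?_⟩
  refine ((LinearMap.toContinuousLinearMap arrayToCLM).le_opNorm (fun i j => A i j)).trans ?_
  gcongr
  exact (pi_norm_le_iff_of_nonneg hK).2 fun i => (pi_norm_le_iff_of_nonneg hK).2 fun j => hA i j

lemma norm_toEuclideanCLM_mul_le (A B : Matrix (Fin 2) (Fin 2) ℝ) :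
    ‖Matrix.toEuclideanCLM (𝕜 := ℝ) (A * B)‖ ≤
      ‖Matrix.toEuclideanCLM (𝕜 := ℝ) A‖ * ‖Matrix.toEuclideanCLM (𝕜 := ℝ) B‖ := by
  rw [map_mul]
  exact norm_mul_le _ _

lemma sqrt_mulVec_le (A : Matrix (Fin 2) (Fin 2) ℝ) {x : Fin 2 → ℝ} (hx : x 0 ^ 2 + x 1 ^ 2 = 1) :
    √((A.mulVec x) 0 ^ 2 + (A.mulVec x) 1 ^ 2) ≤ ‖Matrix.toEuclideanCLM (𝕜 := ℝ) A‖ := by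
  have h := (Matrix.toEuclideanCLM (𝕜 := ℝ) A).le_opNorm (WithLp.toLp 2 x)
  rw [Matrix.toEuclideanCLM_toLp, EuclideanSpace.norm_eq, EuclideanSpace.norm_eq] at h
  simpa [Fin.sum_univ_two, hx] using h

/-- Both columns have length at most the norm, and the sum of the squared entries is at least twice
the determinant. -/
lemma one_le_norm_toEuclideanCLM {A : Matrix (Fin 2) (Fin 2) ℝ} (hA : A.det = 1) :
    1 ≤ ‖Matrix.toEuclideanCLM (𝕜 := ℝ) A‖ := by
  have h0 := sqrt_mulVec_le A (x := ![1, 0]) (by simp)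
  have h1 := sqrt_mulVec_le A (x := ![0, 1]) (by simp)
  simp only [Matrix.mulVec, dotProduct, Fin.sum_univ_two, Matrix.cons_val_zero,
    Matrix.cons_val_one, mul_one, mul_zero, add_zero, zero_add] at h0 h1
  rw [Matrix.det_fin_two] at hA
  set N := ‖Matrix.toEuclideanCLM (𝕜 := ℝ) A‖
  have hN : 0 ≤ N := norm_nonneg _
  rw [sqrt_le_left hN] at h0 h1
  have h2 : 1 ≤ N ^ 2 := by
    nlinarith [sq_nonneg (A 0 0 - A 1 1), sq_nonneg (A 0 1 + A 1 0)]
  exact (one_le_sq_iff₀ hN).1 h2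

/-! ### The cocycle -/

variable {v : Torus → ℝ} {t l : ℝ}

lemma det_cocycle (hl : 0 < l) (ω : Torus) : (cocycle v t l ω).det = 1 := by
  have hg : 0 < gFun v t (catMap ω) := by unfold gFun; positivity
  have h1 : √(gFun v t (catMap ω)) ≠ 0 := (sqrt_pos.2 hg).ne'
  rw [cocycle, Matrix.det_mul, rotation, Matrix.det_fin_two_of, Matrix.det_fin_two_of,
    sqrt_div zero_le_one, sqrt_one]
  have h2 := cos_sq_add_sin_sq (theta v t ω)
  field_simp
  linarith

lemma det_cocycleIter (hl : 0 < l) (n : ℕ) (ω : Torus) : (cocycleIter v t l n ω).det = 1 := by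
  induction n with
  | zero => simp [cocycleIter]
  | succ n ih => rw [cocycleIter, Matrix.det_mul, det_cocycle hl, ih, one_mul]

lemma cocycleIter_add (m n : ℕ) (ω : Torus) :
    cocycleIter v t l (m + n) ω = cocycleIter v t l m (catMap^[n] ω) * cocycleIter v t l n ω := by
  induction m with
  | zero => simp [cocycleIter]
  | succ m ih =>
    rw [Nat.succ_add, cocycleIter, ih, cocycleIter, ← Function.iterate_add_apply, Matrix.mul_assoc]

lemma logNormIter_nonneg (hl : 0 < l) (n : ℕ) (ω : Torus) : 0 ≤ logNormIter v t l n ω :=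
  log_nonneg (one_le_norm_toEuclideanCLM (det_cocycleIter hl n ω))

lemma logNormIter_add_le (hl : 0 < l) (m n : ℕ) (ω : Torus) :
    logNormIter v t l (m + n) ω ≤ logNormIter v t l m (catMap^[n] ω) + logNormIter v t l n ω := by
  have h1 := one_le_norm_toEuclideanCLM (det_cocycleIter (v := v) (t := t) hl (m + n) ω)
  have h2 := one_le_norm_toEuclideanCLM (det_cocycleIter (v := v) (t := t) hl m (catMap^[n] ω))
  have h3 := one_le_norm_toEuclideanCLM (det_cocycleIter (v := v) (t := t) hl n ω)
  unfold logNormIter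
  rw [← log_mul (by linarith) (by linarith)]
  refine log_le_log (by linarith) ?_
  rw [cocycleIter_add]
  exact norm_toEuclideanCLM_mul_le _ _

lemma measurable_cocycle (hv : Measurable v) (i j : Fin 2) :
    Measurable fun ω => cocycle v t l ω i j := by
  have hT := hv.comp continuous_catMap.measurable
  simp only [Function.comp_def] at hT
  fin_cases i <;> fin_cases j <;>
  · simp only [cocycle, rotation, gFun, theta, arccot, Matrix.mul_apply, Fin.sum_univ_two]
    have hm := continuous_catMap.measurable
    simp
    fun_prop

lemma measurable_cocycleIter (hv : Measurable v) (n : ℕ) : ∀ i j : Fin 2,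
    Measurable fun ω => cocycleIter v t l n ω i j := by
  induction n with
  | zero => intro i j; simp only [cocycleIter]; fun_prop
  | succ n ih =>
    intro i j
    simp only [cocycleIter, Matrix.mul_apply, Fin.sum_univ_two]
    have hT : Measurable catMap^[n] := (continuous_catMap.iterate n).measurable
    exact (((measurable_cocycle hv i 0).comp hT).mul (ih 0 j)).add
      (((measurable_cocycle hv i 1).comp hT).mul (ih 1 j))

lemma measurable_logNormIter (hv : Measurable v) (n : ℕ) :
    Measurable (logNormIter v t l n) :=
  measurable_log.comp (measurable_norm_toEuclideanCLM (measurable_cocycleIter hv n))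

lemma one_le_gFun (ω : Torus) : 1 ≤ gFun v t ω := one_le_sq_add_one _

lemma gFun_le_ten (hv : ∀ ω, |v ω| ≤ 1) (ht : t ∈ Set.Icc (-1 : ℝ) 2) (ω : Torus) :
    gFun v t ω ≤ 10 := by
  refine sq_add_one_le_ten ?_
  have := abs_le.1 (hv ω)
  rw [abs_le]
  constructor <;> linarith [ht.1, ht.2]

lemma exists_norm_cocycle_le (hv : ∀ ω, |v ω| ≤ 1) (ht : t ∈ Set.Icc (-1 : ℝ) 2) (hl : 0 < l) :
    ∃ R, ∀ ω, ‖Matrix.toEuclideanCLM (𝕜 := ℝ) (cocycle v t l ω)‖ ≤ R := by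
  obtain ⟨R, hR⟩ := exists_norm_toEuclideanCLM_le (K := l * √10 + 1 / l) (by positivity)
  refine ⟨R, fun ω => hR _ fun i j => ?_⟩
  have h1 : l * √(gFun v t (catMap ω)) ≤ l * √10 := by
    gcongr
    exact gFun_le_ten hv ht _
  have h2 : 1 / l * √(1 / gFun v t (catMap ω)) ≤ 1 / l := by
    refine mul_le_of_le_one_right (by positivity) (sqrt_le_one.2 ?_)
    exact (div_le_one (by linarith [one_le_gFun (v := v) (t := t) (catMap ω)])).2 (one_le_gFun _)
  have h0 : 0 < 1 / l := by positivity
  have h3 : 0 ≤ l * √10 := by positivity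
  have key : ∀ {d x : ℝ}, 0 ≤ d → d ≤ l * √10 + 1 / l → |x| ≤ 1 → |d * x| ≤ l * √10 + 1 / l := by
    intro d x hd hd' hx
    rw [abs_mul, abs_of_nonneg hd]
    exact (mul_le_of_le_one_right hd hx).trans hd'
  have hc := abs_cos_le_one (theta v t ω)
  have hs := abs_sin_le_one (theta v t ω)
  have hd1 : 0 ≤ l * √(gFun v t (catMap ω)) := by positivity
  have hd2 : 0 ≤ 1 / l * √(1 / gFun v t (catMap ω)) := by positivity
  fin_cases i <;> fin_cases j <;> simp only [cocycle, rotation, Matrix.mul_apply,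
    Fin.sum_univ_two, Fin.zero_eta, Fin.mk_one, Matrix.of_apply, Matrix.cons_val_zero,
    Matrix.cons_val_one, zero_mul, add_zero, zero_add]
  · exact key hd1 (by linarith) hc
  · exact key hd1 (by linarith) (by rwa [abs_neg])
  · exact key hd2 (by linarith) hs
  · exact key hd2 (by linarith) hc

lemma exists_norm_cocycleIter_le (hv : ∀ ω, |v ω| ≤ 1) (ht : t ∈ Set.Icc (-1 : ℝ) 2) (hl : 0 < l)
    (n : ℕ) : ∃ R, ∀ ω, ‖Matrix.toEuclideanCLM (𝕜 := ℝ) (cocycleIter v t l n ω)‖ ≤ R := by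
  obtain ⟨R, hR⟩ := exists_norm_cocycle_le hv ht hl
  induction n with
  | zero =>
    exact ⟨‖Matrix.toEuclideanCLM (𝕜 := ℝ) (1 : Matrix (Fin 2) (Fin 2) ℝ)‖, fun ω => le_rfl⟩
  | succ n ih =>
    obtain ⟨S, hS⟩ := ih
    refine ⟨R * S, fun ω => ?_⟩
    rw [cocycleIter]
    refine (norm_toEuclideanCLM_mul_le _ _).trans ?_
    exact mul_le_mul (hR _) (hS ω) (norm_nonneg _) ((norm_nonneg _).trans (hR ω))

lemma integrable_logNormIter (hv : IsAdmissiblePotential v) (ht : t ∈ Set.Icc (-1 : ℝ) 2)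
    (hl : 0 < l) (n : ℕ) : Integrable (logNormIter v t l n) := by
  obtain ⟨R, hR⟩ := exists_norm_cocycleIter_le hv.abs_le_one ht hl n
  refine Integrable.of_bound (measurable_logNormIter hv.measurable n).aestronglyMeasurable
    (log R) (ae_of_all _ fun ω => ?_)
  rw [norm_eq_abs, abs_of_nonneg (logNormIter_nonneg hl n ω)]
  have h1 := one_le_norm_toEuclideanCLM (det_cocycleIter (v := v) (t := t) hl n ω)
  exact log_le_log (by linarith) (hR ω)

/-- Fekete's lemma: invariance of the measure makes the integrals subadditive. -/
lemma exists_tendsto_meanLogNorm (hv : IsAdmissiblePotential v) (ht : t ∈ Set.Icc (-1 : ℝ) 2)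
    (hl : 0 < l) : ∃ L, Filter.Tendsto (meanLogNorm v t l) Filter.atTop (nhds L) := by
  have hint := fun n => integrable_logNormIter hv ht hl n
  have hsub : Subadditive fun n => ∫ ω, logNormIter v t l n ω := by
    intro m n
    have hT := measurePreserving_catMap.iterate n
    have hi : Integrable fun ω => logNormIter v t l m (catMap^[n] ω) :=
      hT.integrable_comp_of_integrable (hint m)
    have h1 : ∫ ω, logNormIter v t l m (catMap^[n] ω) = ∫ ω, logNormIter v t l m ω := by
      conv_rhs => rw [← hT.map_eq]
      rw [integral_map hT.measurable.aemeasurable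
        (measurable_logNormIter hv.measurable m).aestronglyMeasurable]
    change ∫ ω, logNormIter v t l (m + n) ω ≤
      (∫ ω, logNormIter v t l m ω) + ∫ ω, logNormIter v t l n ω
    rw [← h1, ← integral_add hi (hint n)]
    exact integral_mono (hint (m + n)) (hi.add (hint n)) fun ω => logNormIter_add_le hl m n ω
  have hbdd : BddBelow (Set.range fun n : ℕ => (∫ ω, logNormIter v t l n ω) / (n : ℝ)) := by
    refine ⟨0, ?_⟩
    rintro _ ⟨n, rfl⟩
    exact div_nonneg (integral_nonneg fun ω => logNormIter_nonneg hl n ω) n.cast_nonneg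
  refine ⟨hsub.lim, (hsub.tendsto_lim hbdd).congr fun n => ?_⟩
  rw [meanLogNorm, one_div, inv_mul_eq_div]

/-- The image of the first basis vector in polar coordinates. -/
lemma exists_polar_cocycleIter (hv : ∀ ω, |v ω| ≤ 1) (ht : t ∈ Set.Icc (-1 : ℝ) 2) (hl : 0 < l)
    (ω : Torus) (n : ℕ) :
    ∃ r, 0 < r ∧ n * log l - ∑ k ∈ Finset.range n, logLoss ((1 / (10 * l ^ 2)) ^ 2)
        (pruferAngle t l (fun j => v (catMap^[j] ω)) k) ≤ log r ∧
      (cocycleIter v t l n ω).mulVec ![1, 0] =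
        ![r * cos (pruferAngle t l (fun j => v (catMap^[j] ω)) n - theta v t (catMap^[n] ω)),
          r * sin (pruferAngle t l (fun j => v (catMap^[j] ω)) n - theta v t (catMap^[n] ω))] := by
  induction n with
  | zero => exact ⟨1, one_pos, by simp, by simp [cocycleIter, pruferAngle, theta]⟩
  | succ n ih =>
    obtain ⟨r, hr, hlog, hvec⟩ := ih
    set x := pruferAngle t l (fun j => v (catMap^[j] ω)) n with hx
    set g := gFun v t (catMap^[n + 1] ω) with hg
    -- The ratio of the lower to the upper diagonal entry.
    set τ := 1 / (l ^ 2 * g) with hτ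
    have hg1 : 1 ≤ g := one_le_gFun _
    have hg10 : g ≤ 10 := gFun_le_ten hv ht _
    have hg0 : 0 < g := by linarith
    have hτ0 : 0 < τ := by positivity
    have hΔ := cos_sq_add_mul_sin_sq_pos (pow_pos hτ0 2) x
    have hangle : pruferAngle t l (fun j => v (catMap^[j] ω)) (n + 1) -
        theta v t (catMap^[n + 1] ω) = angleMap τ x := by
      rw [pruferAngle, theta, add_sub_cancel_left, hτ, hg, gFun]
    refine ⟨r * (l * √g) * √(cos x ^ 2 + τ ^ 2 * sin x ^ 2), by positivity, ?_, ?_⟩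
    -- As `g ≤ 10`, `τ` may be replaced by a constant, making the loss function the same along all
    -- orbits.
    · have hε : 1 / (10 * l ^ 2) ≤ τ := by
        rw [hτ, mul_comm]
        gcongr
      have h1 : -logLoss ((1 / (10 * l ^ 2)) ^ 2) x ≤
          1 / 2 * log (cos x ^ 2 + τ ^ 2 * sin x ^ 2) := by
        rw [logLoss, neg_neg]
        have := cos_sq_add_mul_sin_sq_pos (τ := (1 / (10 * l ^ 2)) ^ 2) (by positivity) x
        gcongr
      rw [log_mul (by positivity) (by positivity), log_mul hr.ne' (by positivity),
        log_mul hl.ne' (by positivity), log_sqrt hg0.le, log_sqrt hΔ.le, Finset.sum_range_succ,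
        ← hx]
      have h2 := log_nonneg hg1
      push_cast
      linarith
    · have hcos : l * √g * (√(cos x ^ 2 + τ ^ 2 * sin x ^ 2) * cos (angleMap τ x)) =
          l * √g * cos x := by rw [sqrt_mul_cos_angleMap hτ0]
      have hsin : l * √g * (√(cos x ^ 2 + τ ^ 2 * sin x ^ 2) * sin (angleMap τ x)) =
          1 / l * √(1 / g) * sin x := by
        rw [sqrt_mul_sin_angleMap hτ0, sqrt_div zero_le_one, sqrt_one, hτ]
        have h1 : √g ≠ 0 := (sqrt_pos.2 hg0).ne'
        have h2 := sq_sqrt hg0.le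
        field_simp
        rw [h2]
      have hx1 : x = x - theta v t (catMap^[n] ω) + theta v t (catMap^[n] ω) := by ring
      rw [hangle, cocycleIter, ← Matrix.mulVec_mulVec, hvec, cocycle, ← Matrix.mulVec_mulVec,
        ← Function.iterate_succ_apply' catMap, ← hg]
      have hrot : (rotation (theta v t (catMap^[n] ω))).mulVec
          ![r * cos (x - theta v t (catMap^[n] ω)), r * sin (x - theta v t (catMap^[n] ω))] =
          ![r * cos x, r * sin x] := by
        conv_rhs => rw [hx1, cos_add, sin_add]
        ext i
        fin_cases i <;> simp [rotation, Matrix.mulVec, dotProduct, Fin.sum_univ_two] <;> ring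
      rw [hrot]
      ext i
      fin_cases i
      · simp only [Matrix.mulVec, dotProduct, Fin.sum_univ_two]
        simp
        linear_combination -r * hcos
      · simp only [Matrix.mulVec, dotProduct, Fin.sum_univ_two]
        simp
        simp only [one_div] at hsin
        rw [sqrt_inv] at hsin
        linear_combination -r * hsin

lemma le_logNormIter (hv : ∀ ω, |v ω| ≤ 1) (ht : t ∈ Set.Icc (-1 : ℝ) 2) (hl : 0 < l)
    (ω : Torus) (n : ℕ) :
    n * log l - ∑ k ∈ Finset.range n, logLoss ((1 / (10 * l ^ 2)) ^ 2)
        (pruferAngle t l (fun j => v (catMap^[j] ω)) k) ≤ logNormIter v t l n ω := by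
  obtain ⟨r, hr, hlog, hvec⟩ := exists_polar_cocycleIter hv ht hl ω n
  refine hlog.trans (log_le_log hr ?_)
  have h := sqrt_mulVec_le (cocycleIter v t l n ω) (x := ![1, 0]) (by simp)
  rw [hvec] at h
  simp only [Matrix.cons_val_zero, Matrix.cons_val_one, mul_pow, ← mul_add, cos_sq_add_sin_sq,
    mul_one, sqrt_sq hr.le] at h
  exact h

/-- The lower bound for large coupling constants. -/
lemma le_meanLogNorm (hv : IsAdmissiblePotential v) {c M C : ℝ}
    (hc0 : 0 < c) (hcM : c ≤ M)
    (hc : ∀ p ∈ unitSquare, c < unstableDeriv v p) (hM : ∀ p ∈ unitSquare, unstableDeriv v p ≤ M)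
    (ht : t ∈ Set.Icc (-1 : ℝ) 2) (hl1 : 1 ≤ l) (hl : 435 * (1 + 40 * M / c) ≤ l ^ 2)
    {K : ℝ} (hK : ∀ ε, 0 < ε → ε ≤ 1 →
      ∃ κ ψ, 0 ≤ κ ∧ κ ≤ K ∧ (∀ x, HasDerivAt ψ (logLoss ε x - κ) x) ∧ ∀ x, |ψ x| ≤ K)
    (hC : C = 20 * (2 * K + 6 * π * K) * 11 / c) {n : ℕ} (hn : n ≠ 0) :
    log l - C ≤ meanLogNorm v t l n := by
  have hl0 : 0 < l := by linarith
  set ε := (1 / (10 * l ^ 2)) ^ 2 with hε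
  have hε0 : 0 < ε := by positivity
  have hε1 : ε ≤ 1 := by
    refine pow_le_one₀ (by positivity) ((div_le_one (by positivity)).2 ?_)
    linarith [one_le_pow₀ hl1 (n := 2)]
  -- `ε` tends to `0` as `l` grows; that `K` does not depend on `ε` makes `C` independent of `l`.
  obtain ⟨κ, ψ, hκ, hκK, hψ, hψK⟩ := hK ε hε0 hε1
  have hm : ∀ k, Measurable fun ω =>
      logLoss ε (pruferAngle t l (fun j => v (catMap^[j] ω)) k) := fun k =>
    (continuous_logLoss hε0).measurable.comp (measurable_pruferAngle t l
      (fun j => hv.measurable.comp (continuous_catMap.iterate j).measurable) k)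
  have hb : ∀ k ω, ‖logLoss ε (pruferAngle t l (fun j => v (catMap^[j] ω)) k)‖ ≤
      -(1 / 2 * log ε) := fun k ω => by
    rw [norm_eq_abs, abs_of_nonneg (logLoss_nonneg hε0 hε1 _)]
    exact logLoss_le_log hε0 hε1 _
  have hi : ∀ k, Integrable fun ω =>
      logLoss ε (pruferAngle t l (fun j => v (catMap^[j] ω)) k) := fun k =>
    Integrable.of_bound (hm k).aestronglyMeasurable _ (ae_of_all _ (hb k))
  have hloss : ∀ k, ∫ ω, logLoss ε (pruferAngle t l (fun j => v (catMap^[j] ω)) k) ≤ C := by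
    intro k
    refine integral_le_of_integral_unstable_le (hm k) (hb k) fun ω => ?_
    obtain ⟨B, hB⟩ := exists_isExpanding hv hc hM ω
    rw [hC]
    exact hB.integral_logLoss_le two_le_unstableEigenvalue unstableEigenvalue_le_three hc0 hcM ht
      hl1 hl hε0 hε1 hκ hκK hψ hψK k
  have h1 : ∫ ω, (n * log l - ∑ k ∈ Finset.range n,
      logLoss ε (pruferAngle t l (fun j => v (catMap^[j] ω)) k)) ≤
      ∫ ω, logNormIter v t l n ω :=
    integral_mono ((integrable_const _).sub (integrable_finsetSum _ fun k _ => hi k))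
      (integrable_logNormIter hv ht hl0 n) fun ω => le_logNormIter hv.abs_le_one ht hl0 ω n
  rw [integral_sub (integrable_const _) (integrable_finsetSum _ fun k _ => hi k),
    integral_finsetSum _ fun k _ => hi k] at h1
  have h2 : ∑ k ∈ Finset.range n, ∫ ω, logLoss ε (pruferAngle t l (fun j => v (catMap^[j] ω)) k) ≤
      n * C := by
    refine (Finset.sum_le_sum fun k _ => hloss k).trans ?_
    simp
  have h3 : ∫ _ω : Torus, (n : ℝ) * log l = n * log l := by simp
  have hn0 : (0 : ℝ) < n := by positivity
  rw [meanLogNorm, one_div, inv_mul_eq_div, le_div_iff₀ hn0]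
  linarith

end

end CatMap

/-! ### The constant and the two ranges of the coupling -/

theorem theorem3p1 (v : CatMap.Torus → ℝ) (hv : CatMap.IsAdmissiblePotential v) :
    ∃ C₀ : ℝ, 0 < C₀ ∧ ∀ l : ℝ, 0 < l → ∀ t ∈ Set.Icc (-1 : ℝ) 2,
      (∀ n : ℕ, MeasureTheory.Integrable (CatMap.logNormIter v t l n)) ∧
      Filter.Tendsto (CatMap.meanLogNorm v t l) Filter.atTop
        (nhds (CatMap.lyapunovExponent v t l)) ∧
      Real.log l - C₀ < CatMap.lyapunovExponent v t l := by
  obtain ⟨c, hc0, hc⟩ := hv.unstableDeriv_lower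
  obtain ⟨M, hM⟩ := hv.unstableDeriv_upper
  obtain ⟨K, hK0, hK⟩ := CatMap.exists_bounded_primitive_logLoss
  have hcM : c ≤ M := by
    have h0 : ((0, 0) : ℝ × ℝ) ∈ CatMap.unitSquare := by simp [CatMap.unitSquare]
    exact (hc _ h0).le.trans (hM _ h0)
  have hM0 : 0 < M := hc0.trans_le hcM
  set C := 20 * (2 * K + 6 * Real.pi * K) * 11 / c with hC
  have hCpos : 0 < C := by positivity
  set l₀ := √(435 * (1 + 40 * M / c)) with hl₀
  have hl₀1 : 1 ≤ l₀ := by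
    refine Real.one_le_sqrt.2 ?_
    have : 0 < 40 * M / c := by positivity
    linarith
  have hlog₀ := Real.log_nonneg hl₀1
  -- `C` serves `l ≥ l₀`, `log l₀` serves `l ≤ l₀` through `L ≥ 0`, and `1` makes the inequality
  -- strict.
  refine ⟨C + Real.log l₀ + 1, by positivity, fun l hl t ht => ?_⟩
  obtain ⟨L, hL⟩ := CatMap.exists_tendsto_meanLogNorm hv ht hl
  have hLim : CatMap.lyapunovExponent v t l = L := hL.limUnder_eq
  refine ⟨CatMap.integrable_logNormIter hv ht hl, hLim ▸ hL, ?_⟩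
  rw [hLim]
  rcases le_total l l₀ with h | h
  · have h1 : 0 ≤ L := ge_of_tendsto' hL fun n => mul_nonneg (by positivity)
      (MeasureTheory.integral_nonneg fun ω => CatMap.logNormIter_nonneg hl n ω)
    have h2 := Real.log_le_log hl h
    linarith
  · have h1 : Real.log l - C ≤ L := by
      refine ge_of_tendsto hL ?_
      filter_upwards [Filter.eventually_ne_atTop 0] with n hn
      refine CatMap.le_meanLogNorm hv hc0 hcM hc hM ht (hl₀1.trans h) ?_ hK hC hn
      have h3 : l₀ ^ 2 = 435 * (1 + 40 * M / c) := Real.sq_sqrt (by positivity)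
      rw [← h3]
      gcongr
    linarith
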